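/- Theorem 4.1. Let $\mathcal{A}$ be a complex Banach algebra with identity. An element $a$ of a ring with identity $R$ is called quasinilpotent if $1+ax$ is invertible for every $x\in R$ with $xa=ax$. A g-Drazin inverse of $a\in R$ is an element $b\in R$ with $ab=ba$, $b=bab$ and $a-a^2b$ quasinilpotent. In $\mathcal{A}$ and in $M_2(\mathcal{A})$ such a $b$ is unique if it exists; it is then written $a^d$, one says that $a$ is g-Drazin invertible, and one puts $a^\pi=1-aa^d$. Let $A,B,C,D\in\mathcal{A}$ and let $\lambda\in\mathbb{C}$ be nonzero. Suppose that $A$ and $D$ are g-Drazin invertible and that $$BD=\lambda A^\pi AB,\qquad DC=\lambda^{-1}D^\pi CAA^\pi,\qquad BC=0.$$ Then the two series below converge in $\mathcal{A}$, the matrix $M=\begin{pmatrix}A&B\\C&D\end{pmatrix}\in M_2(\mathcal{A})$ is g-Drazin invertible in $M_2(\mathcal{A})$, and $$M^d=\begin{pmatrix}A^d&(A^d)^2B+\sum_{n=0}^{\infty}A^nB(D^d)^{n+2}\\[2pt] C(A^d)^2&D^d+C(A^d)^3B+\sum_{n=0}^{\infty}\sum_{k=1}^{n}D^{k-1}CA^{n-k}B(D^d)^{n+2}\end{pmatrix}$$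 (the inner sum is empty, hence $0$, for $n=0$). -/

import Mathlib

/-- The quasinilpotent elements of a ring: `1 + a x` is invertible for every `x` in the
commutant of `a`. -/
def IsQuasinilp {R : Type*} [Ring R] (a : R) : Prop :=
  ∀ x : R, x * a = a * x → IsUnit (1 + a * x)

/-- `b` is a generalized Drazin inverse (g-Drazin inverse) of `a`: `b` commutes with `a`,
`b = b a b`, and `a - a² b` is quasinilpotent. -/
structure IsGDrazinInverse {R : Type*} [Ring R] (a b : R) : Prop where
  comm : b * a = a * b
  outer : b = b * a * b
  quasinilp : IsQuasinilp (a - a ^ 2 * b)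

/-- The spectral idempotent `1 - a b` of `a`, for `b` the g-Drazin inverse of `a`. -/
def spectralIdem {R : Type*} [Ring R] (a b : R) : R := 1 - a * b

/-!
Write `P = 1 - A Ad` and `Q = 1 - D Dd`. Everything rests on the fact that in a complex Banach
algebra `a` is quasinilpotent as soon as all `1 + z a` with `z` a scalar are invertible
(`isQuasinilp_iff_isUnit_smul`); by Gelfand's formula the powers of such an `a` decay faster than
any geometric sequence (`IsQuasinilp.exists_norm_pow_le`). The same decay shows that an equation
`w = a w v` with `a` quasinilpotent forces `w = 0`. This gives the uniqueness of g-Drazin inverses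
(`IsGDrazinInverse.unique`), and, applied to `B Dd = (A P) (B Dd) (λ Dd)`, it gives `B Dd = 0`.
Thus the hypotheses make every term of the two series vanish. Moreover `Dd C = 0` and
`Ad B D = D C Ad = 0`, and with these relations the displayed matrix `X` is an outer inverse of `M`
commuting with `M`, by multiplying out.

There remains the quasinilpotency of `M - M² X`, which is the matrix with rows `A P`, `P B` and
`C P`, `D Q - C Ad B`. It is `E + T` for the diagonal part `E` and the off-diagonal part `T`. The
relations above give `T E = λ E T`, while `B C = 0` gives `T ^ 3 = 0`; and `E` is quasinilpotent
because `C Ad B` squares to zero and satisfies `(D Q) (C Ad B) = 0`. So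
`1 + z (E + T) = (1 + z T (1 + z E)⁻¹) (1 + z E)`, where `T (1 + z E)⁻¹` is nilpotent because `T`
can be moved past the inverse at the cost of replacing `z` by `λ z`
(`isUnit_one_add_smul_add_of_skew_commute`).
-/

/-! ### Quasinilpotent elements of a Banach algebra -/

section Banach

variable {R : Type*} [NormedRing R] [NormedAlgebra ℂ R]

theorem IsQuasinilp.isUnit_one_add_smul {a : R} (h : IsQuasinilp a) (z : ℂ) :
    IsUnit (1 + z • a) := by
  simpa using h (z • 1) (by simp)

variable [CompleteSpace R]

/-- If all `1 + z a` are invertible then the spectral radius of `a` is zero, so that the powers of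
`a` decay faster than any geometric sequence. -/
theorem exists_norm_pow_le_of_isUnit {a : R} (h : ∀ z : ℂ, IsUnit (1 + z • a)) {r : ℝ}
    (hr : 0 < r) : ∃ m : ℕ, ∀ n ≥ m, ‖a ^ n‖ ≤ r ^ n := by
  have hrad : spectralRadius ℂ a = 0 := by
    refine le_antisymm (iSup₂_le fun k hk => ?_) bot_le
    by_contra hne
    have hk0 : k ≠ 0 := by
      rintro rfl
      simp at hne
    refine hk (spectrum.mem_resolventSet_iff.2 ?_)
    have h1 : algebraMap ℂ R k - a = k • (1 + (-k⁻¹) • a) := by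
      rw [smul_add, smul_smul, mul_neg, mul_inv_cancel₀ hk0, Algebra.algebraMap_eq_smul_one]
      simp [sub_eq_add_neg]
    rw [h1]
    exact (h _).smul (Units.mk0 k hk0)
  have hlim := spectrum.pow_norm_pow_one_div_tendsto_nhds_spectralRadius a
  rw [hrad] at hlim
  have hev := hlim.eventually (gt_mem_nhds (ENNReal.ofReal_pos.2 hr))
  obtain ⟨m, hm⟩ := Filter.eventually_atTop.1 hev
  refine ⟨m + 1, fun n hn => ?_⟩
  have h1 := (ENNReal.ofReal_lt_ofReal_iff hr).1 (hm n (by omega))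
  have h2 := pow_le_pow_left₀ (by positivity) h1.le n
  rwa [one_div, Real.rpow_inv_natCast_pow (norm_nonneg _) (by omega)] at h2

theorem IsQuasinilp.exists_norm_pow_le {a : R} (h : IsQuasinilp a) {r : ℝ} (hr : 0 < r) :
    ∃ m : ℕ, ∀ n ≥ m, ‖a ^ n‖ ≤ r ^ n :=
  exists_norm_pow_le_of_isUnit h.isUnit_one_add_smul hr

/-- In a complex Banach algebra it suffices to test quasinilpotency on scalars. -/
theorem isQuasinilp_iff_isUnit_smul {a : R} :
    IsQuasinilp a ↔ ∀ z : ℂ, IsUnit (1 + z • a) := by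
  refine ⟨IsQuasinilp.isUnit_one_add_smul, fun h x hx => ?_⟩
  obtain ⟨m, hm⟩ := exists_norm_pow_le_of_isUnit h (r := (2 * (‖x‖ + 1))⁻¹) (by positivity)
  set n := m + 1
  have hpow : (-(a * x)) ^ n = (-1) ^ n * (a ^ n * x ^ n) := by
    rw [neg_pow, (show Commute a x from hx.symm).mul_pow]
  have hlt : ‖(-(a * x)) ^ n‖ < 1 := by
    have h1 : ‖(-(a * x)) ^ n‖ = ‖a ^ n * x ^ n‖ := by
      rw [hpow]
      rcases neg_one_pow_eq_or R n with h | h <;> simp [h]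
    calc ‖(-(a * x)) ^ n‖ = ‖a ^ n * x ^ n‖ := h1
      _ ≤ ‖a ^ n‖ * ‖x ^ n‖ := norm_mul_le _ _
      _ ≤ (2 * (‖x‖ + 1))⁻¹ ^ n * (‖x‖ + 1) ^ n := by
          gcongr
          · exact hm n (by omega)
          · exact (norm_pow_le' x (by omega)).trans (by gcongr; linarith)
      _ = (1 / 2) ^ n := by
          rw [← mul_pow]
          congr 1
          have : ‖x‖ + 1 ≠ 0 := by positivity
          field_simp
      _ < 1 := pow_lt_one₀ (by norm_num) (by norm_num) (by omega)
  have hunit : IsUnit (1 - (-(a * x)) ^ n) := isUnit_one_sub_of_norm_lt_one hlt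
  -- `1 + a x` divides `1 - (-a x) ^ n`, with a commuting cofactor.
  have hgeom := mul_neg_geom_sum (-(a * x)) n
  rw [← hgeom, Commute.isUnit_mul_iff] at hunit
  · simpa using hunit.1
  · rw [commute_iff_eq, mul_neg_geom_sum, geom_sum_mul_neg]

theorem eq_zero_of_norm_le_norm_pow {a w : R} (ha : IsQuasinilp a) {K s : ℝ} (hK : 0 ≤ K)
    (hs : 0 ≤ s) (h : ∀ n : ℕ, ‖w‖ ≤ K * ‖a ^ (n + 1)‖ * s ^ (n + 1)) : w = 0 := by
  obtain ⟨m, hm⟩ := ha.exists_norm_pow_le (r := (2 * (s + 1))⁻¹) (by positivity)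
  have hlim : Filter.Tendsto (fun n : ℕ => K * (1 / 2 : ℝ) ^ (n + 1)) Filter.atTop
      (nhds (K * 0)) :=
    ((tendsto_pow_atTop_nhds_zero_of_lt_one (by norm_num) (by norm_num)).comp
      (Filter.tendsto_add_atTop_nat 1)).const_mul K
  have hle : ‖w‖ ≤ K * 0 := by
    refine ge_of_tendsto hlim ?_
    filter_upwards [Filter.eventually_ge_atTop m] with n hn
    calc ‖w‖ ≤ K * ‖a ^ (n + 1)‖ * s ^ (n + 1) := h n
      _ ≤ K * (2 * (s + 1))⁻¹ ^ (n + 1) * (s + 1) ^ (n + 1) := by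
          gcongr
          · exact hm _ (by omega)
          · linarith
      _ = K * (1 / 2) ^ (n + 1) := by
          rw [mul_assoc, ← mul_pow]
          congr 2
          have : s + 1 ≠ 0 := by positivity
          field_simp
  simpa using hle

theorem eq_zero_of_eq_mul_mul {a v w : R} (ha : IsQuasinilp a) (h : w = a * w * v) : w = 0 := by
  have hn : ∀ n : ℕ, w = a ^ n * w * v ^ n := by
    intro n
    induction n with
    | zero => simp
    | succ n ih =>
      calc w = a ^ n * (a * w * v) * v ^ n := by rw [← h]; exact ih
        _ = a ^ (n + 1) * w * v ^ (n + 1) := by rw [pow_succ a, pow_succ' v]; noncomm_ring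
  refine eq_zero_of_norm_le_norm_pow ha (norm_nonneg w) (norm_nonneg v) fun n => ?_
  calc ‖w‖ = ‖a ^ (n + 1) * w * v ^ (n + 1)‖ := by rw [← hn]
    _ ≤ ‖a ^ (n + 1)‖ * ‖w‖ * ‖v‖ ^ (n + 1) := by
        refine (norm_mul_le _ _).trans ?_
        gcongr
        · exact norm_mul_le _ _
        · exact norm_pow_le' v n.succ_pos
    _ = ‖w‖ * ‖a ^ (n + 1)‖ * ‖v‖ ^ (n + 1) := by ring

theorem eq_zero_of_eq_mul_mul' {a v w : R} (ha : IsQuasinilp a) (h : w = v * w * a) : w = 0 := by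
  have hn : ∀ n : ℕ, w = v ^ n * w * a ^ n := by
    intro n
    induction n with
    | zero => simp
    | succ n ih =>
      calc w = v ^ n * (v * w * a) * a ^ n := by rw [← h]; exact ih
        _ = v ^ (n + 1) * w * a ^ (n + 1) := by rw [pow_succ v, pow_succ' a]; noncomm_ring
  refine eq_zero_of_norm_le_norm_pow ha (norm_nonneg w) (norm_nonneg v) fun n => ?_
  calc ‖w‖ = ‖v ^ (n + 1) * w * a ^ (n + 1)‖ := by rw [← hn]
    _ ≤ ‖v‖ ^ (n + 1) * ‖w‖ * ‖a ^ (n + 1)‖ := by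
        refine (norm_mul_le _ _).trans ?_
        gcongr
        refine (norm_mul_le _ _).trans ?_
        gcongr
        exact norm_pow_le' v n.succ_pos
    _ = ‖w‖ * ‖a ^ (n + 1)‖ * ‖v‖ ^ (n + 1) := by ring

/-- The definition does not make `b` and `c` commute, so that the idempotents `a b` and `a c` are
compared from both sides: for `q = 1 - a c` one has `a b q = b (a b q) (a q)` and
`q a b = (a q) (q a b) b` with `a q` quasinilpotent, so both vanish. Exchanging `b` and `c` gives
`a b = a c`, hence `b = c`. -/
theorem IsGDrazinInverse.unique {a b c : R} (hb : IsGDrazinInverse a b)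
    (hc : IsGDrazinInverse a c) : b = c := by
  have key : ∀ {x y : R}, IsGDrazinInverse a x → IsGDrazinInverse a y →
      a * x = a * x * (a * y) ∧ a * x = a * y * (a * x) := by
    intro x y hx hy
    have hx1 := hx.comm
    have hx2 : x * (a * x) = x := by rw [← mul_assoc]; exact hx.outer.symm
    have hx3 : a * x * x = x := by rw [← hx1, mul_assoc, hx2]
    have hy1 := hy.comm
    have hay : a * (a * y) = a * y * a := by rw [mul_assoc, hy1]
    have hyy : a * y * (a * y) = a * y := by
      rw [mul_assoc, ← mul_assoc y, ← hy.outer]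
    have hq : (1 - a * y) * (a - a ^ 2 * y) = a - a ^ 2 * y := by
      have : a * y * (a - a ^ 2 * y) = 0 := by
        rw [pow_two, mul_assoc a a, hay, mul_sub, ← mul_assoc (a * y) (a * y), hyy, sub_self]
      rw [sub_mul, this, one_mul, sub_zero]
    have hq' : a - a ^ 2 * y = (1 - a * y) * a := by
      rw [pow_two, mul_assoc, hay, sub_mul, one_mul]
    have hq'' : a - a ^ 2 * y = a * (1 - a * y) := by
      rw [pow_two, mul_assoc, mul_sub, mul_one]
    have hidem : (1 - a * y) * (1 - a * y) = 1 - a * y := by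
      rw [mul_sub, mul_one, sub_mul, hyy, one_mul, sub_self, sub_zero]
    constructor
    · have h0 : a * x * (1 - a * y) = 0 := by
        refine eq_zero_of_eq_mul_mul' (v := x) hy.quasinilp ?_
        calc a * x * (1 - a * y) = (x * (a * x)) * a * (1 - a * y) := by rw [hx2, hx1]
          _ = x * (a * x) * ((1 - a * y) * (a - a ^ 2 * y)) := by rw [hq, hq'']; noncomm_ring
          _ = x * (a * x * (1 - a * y)) * (a - a ^ 2 * y) := by noncomm_ring
      rw [mul_sub, mul_one] at h0
      exact sub_eq_zero.1 h0
    · have h0 : (1 - a * y) * (a * x) = 0 := by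
        refine eq_zero_of_eq_mul_mul (v := x) hy.quasinilp ?_
        calc (1 - a * y) * (a * x) = (1 - a * y) * (1 - a * y) * a * (a * x * x) := by
              rw [hx3, hidem, mul_assoc]
          _ = (1 - a * y) * a * (1 - a * y) * (a * x * x) := by
              rw [mul_assoc (1 - a * y) a (1 - a * y), ← hq'', hq', mul_assoc (1 - a * y) (1 - a * y) a]
          _ = (a - a ^ 2 * y) * ((1 - a * y) * (a * x)) * x := by rw [hq']; noncomm_ring
      rw [sub_mul, one_mul] at h0
      exact sub_eq_zero.1 h0
  have hab : a * b = a * c := by rw [(key hb hc).1]; exact (key hc hb).2.symm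
  calc b = b * (a * b) := by rw [← mul_assoc]; exact hb.outer
    _ = a * b * c := by rw [hab, ← mul_assoc, hb.comm, hab]
    _ = c := by rw [hab, ← hc.comm]; exact hc.outer.symm

end Banach

/-! ### Skew-commuting perturbations -/

/-- A nilpotent `T` with `T E = λ E T` does not disturb the invertibility of `1 + z E`. -/
theorem isUnit_one_add_smul_add_of_skew_commute {R : Type*} [Ring R] [Algebra ℂ R] {E T : R}
    {lam : ℂ} (hE : ∀ z : ℂ, IsUnit (1 + z • E)) (hTE : T * E = lam • (E * T))
    (hT : T ^ 3 = 0) (z : ℂ) : IsUnit (1 + z • (E + T)) := by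
  choose U hU using hE
  have hmove : ∀ t : ℂ, T * ((U t)⁻¹ : Rˣ) = ((U (lam * t))⁻¹ : Rˣ) * T := by
    intro t
    rw [Units.eq_inv_mul_iff_mul_eq, ← mul_assoc, Units.mul_inv_eq_iff_eq_mul, hU, hU, mul_add,
      add_mul, mul_smul_comm, hTE, smul_smul, smul_mul_assoc, mul_comm t]
    simp
  have hnil : IsNilpotent (z • (T * ((U z)⁻¹ : Rˣ))) := by
    refine ⟨3, ?_⟩
    have h3 : (T * ((U z)⁻¹ : Rˣ)) ^ 3 = ((U (lam * z))⁻¹ : Rˣ) *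
        ((U (lam * (lam * z)))⁻¹ : Rˣ) * T ^ 3 * ((U z)⁻¹ : Rˣ) := by
      calc (T * ((U z)⁻¹ : Rˣ)) ^ 3
          = (T * ((U z)⁻¹ : Rˣ)) * (T * ((U z)⁻¹ : Rˣ)) * T * ((U z)⁻¹ : Rˣ) := by noncomm_ring
        _ = ((U (lam * z))⁻¹ : Rˣ) * T * (((U (lam * z))⁻¹ : Rˣ) * T) * T * ((U z)⁻¹ : Rˣ) := by
            rw [hmove]
        _ = ((U (lam * z))⁻¹ : Rˣ) * (T * ((U (lam * z))⁻¹ : Rˣ)) * T * T * ((U z)⁻¹ : Rˣ) := by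
            noncomm_ring
        _ = _ := by rw [hmove]; noncomm_ring
    rw [smul_pow, h3, hT]
    simp
  have hfac : 1 + z • (E + T) = (1 + z • (T * ((U z)⁻¹ : Rˣ))) * (U z : R) := by
    rw [add_mul, one_mul, smul_mul_assoc, Units.inv_mul_cancel_right, hU, smul_add, add_assoc]
  rw [hfac]
  exact hnil.isUnit_one_add.mul (U z).isUnit

/-! ### Two by two matrices over a Banach algebra -/

section TwoByTwo

variable {𝓐 : Type*} [NormedRing 𝓐] [NormedAlgebra ℂ 𝓐] [CompleteSpace 𝓐]

theorem Matrix.isQuasinilp_of_isUnit_smul {N : Matrix (Fin 2) (Fin 2) 𝓐}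
    (h : ∀ z : ℂ, IsUnit (1 + z • N)) : IsQuasinilp N := by
  let _ : NormedRing (Matrix (Fin 2) (Fin 2) 𝓐) := Matrix.linftyOpNormedRing
  let _ : NormedAlgebra ℂ (Matrix (Fin 2) (Fin 2) 𝓐) := Matrix.linftyOpNormedAlgebra
  -- The uniform structure of this norm is definitionally that of the product.
  have : @CompleteSpace (Matrix (Fin 2) (Fin 2) 𝓐) PseudoMetricSpace.toUniformSpace :=
    (inferInstance : CompleteSpace (Fin 2 → Fin 2 → 𝓐))
  exact isQuasinilp_iff_isUnit_smul.2 h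

theorem Matrix.isGDrazinInverse_unique {M X Y : Matrix (Fin 2) (Fin 2) 𝓐}
    (hX : IsGDrazinInverse M X) (hY : IsGDrazinInverse M Y) : X = Y := by
  let _ : NormedRing (Matrix (Fin 2) (Fin 2) 𝓐) := Matrix.linftyOpNormedRing
  let _ : NormedAlgebra ℂ (Matrix (Fin 2) (Fin 2) 𝓐) := Matrix.linftyOpNormedAlgebra
  -- The uniform structure of this norm is definitionally that of the product.
  have : @CompleteSpace (Matrix (Fin 2) (Fin 2) 𝓐) PseudoMetricSpace.toUniformSpace :=
    (inferInstance : CompleteSpace (Fin 2 → Fin 2 → 𝓐))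
  exact hX.unique hY

theorem Matrix.isUnit_diagonal_fin_two {R : Type*} [Ring R] {a d : R} (ha : IsUnit a)
    (hd : IsUnit d) : IsUnit (!![a, 0; 0, d] : Matrix (Fin 2) (Fin 2) R) := by
  obtain ⟨u, rfl⟩ := ha
  obtain ⟨v, rfl⟩ := hd
  refine ⟨⟨!![(u : R), 0; 0, v], !![((u⁻¹ : Rˣ) : R), 0; 0, ((v⁻¹ : Rˣ) : R)], ?_, ?_⟩, rfl⟩ <;>
    simp [Matrix.one_fin_two]

/-- The skew-commutation `b d = λ a b`, `d c = λ⁻¹ c a` together with `b c = 0` makes a block matrix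
with quasinilpotent diagonal entries quasinilpotent. -/
theorem Matrix.isQuasinilp_fin_two {a b c d : 𝓐} {lam : ℂ} (hlam : lam ≠ 0)
    (ha : ∀ z : ℂ, IsUnit (1 + z • a)) (hd : ∀ z : ℂ, IsUnit (1 + z • d))
    (hbd : b * d = lam • (a * b)) (hdc : d * c = lam⁻¹ • (c * a)) (hbc : b * c = 0) :
    IsQuasinilp (!![a, b; c, d] : Matrix (Fin 2) (Fin 2) 𝓐) := by
  have hca : c * a = lam • (d * c) := by rw [hdc, smul_smul, mul_inv_cancel₀ hlam, one_smul]
  have hsum : (!![a, b; c, d] : Matrix (Fin 2) (Fin 2) 𝓐) = !![a, 0; 0, d] + !![0, b; c, 0] := by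
    simp
  rw [hsum]
  refine Matrix.isQuasinilp_of_isUnit_smul
    (isUnit_one_add_smul_add_of_skew_commute (lam := lam) (fun z => ?_) ?_ ?_)
  · have h1 : (1 + z • !![a, 0; 0, d] : Matrix (Fin 2) (Fin 2) 𝓐) =
        !![1 + z • a, 0; 0, 1 + z • d] := by
      simp [Matrix.one_fin_two]
    rw [h1]
    exact Matrix.isUnit_diagonal_fin_two (ha z) (hd z)
  · simp [hbd, hca]
  · rw [pow_succ, pow_two, Matrix.mul_fin_two, Matrix.mul_fin_two]
    simp only [mul_zero, zero_mul, add_zero, hbc, mul_assoc]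
    exact (Matrix.eta_fin_two 0).symm

end TwoByTwo

theorem theorem4p1 {𝓐 : Type*} [NormedRing 𝓐] [NormedAlgebra ℂ 𝓐] [CompleteSpace 𝓐]
    (A B C D Ad Dd : 𝓐) (lam : ℂ) (hlam : lam ≠ 0)
    (hA : IsGDrazinInverse A Ad) (hD : IsGDrazinInverse D Dd)
    (hBD : B * D = lam • (spectralIdem A Ad * A * B))
    (hDC : D * C = lam⁻¹ • (spectralIdem D Dd * C * A * spectralIdem A Ad))
    (hBC : B * C = 0) :
    Summable (fun n : ℕ => A ^ n * B * Dd ^ (n + 2)) ∧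
    Summable (fun n : ℕ =>
      ∑ k ∈ Finset.Icc 1 n, D ^ (k - 1) * C * A ^ (n - k) * B * Dd ^ (n + 2)) ∧
    IsGDrazinInverse (!![A, B; C, D] : Matrix (Fin 2) (Fin 2) 𝓐)
      !![Ad, Ad ^ 2 * B + ∑' n : ℕ, A ^ n * B * Dd ^ (n + 2);
         C * Ad ^ 2, Dd + C * Ad ^ 3 * B + ∑' n : ℕ,
           ∑ k ∈ Finset.Icc 1 n, D ^ (k - 1) * C * A ^ (n - k) * B * Dd ^ (n + 2)] ∧
    ∀ Y : Matrix (Fin 2) (Fin 2) 𝓐, IsGDrazinInverse !![A, B; C, D] Y →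
      Y = !![Ad, Ad ^ 2 * B + ∑' n : ℕ, A ^ n * B * Dd ^ (n + 2);
         C * Ad ^ 2, Dd + C * Ad ^ 3 * B + ∑' n : ℕ,
           ∑ k ∈ Finset.Icc 1 n, D ^ (k - 1) * C * A ^ (n - k) * B * Dd ^ (n + 2)] := by
  unfold spectralIdem at hBD hDC
  have a1 : Ad * A = A * Ad := hA.comm
  have a2 : A * (Ad * Ad) = Ad := by rw [← mul_assoc, ← a1]; exact hA.outer.symm
  have a2' : A * (Ad * (Ad * B)) = Ad * B := by rw [← mul_assoc Ad, ← mul_assoc A, a2]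
  have d1 : Dd * D = D * Dd := hD.comm
  have d2 : D * (Dd * Dd) = Dd := by rw [← mul_assoc, ← d1]; exact hD.outer.symm
  have hAdP : Ad * (1 - A * Ad) = 0 := by
    rw [mul_sub, mul_one, ← mul_assoc, a1, mul_assoc, a2, sub_self]
  have hPAd : (1 - A * Ad) * Ad = 0 := by rw [sub_mul, one_mul, mul_assoc, a2, sub_self]
  have hAP : A * (1 - A * Ad) = (1 - A * Ad) * A := by
    rw [mul_sub, sub_mul, mul_one, one_mul, mul_assoc, a1]
  have hPP : (1 - A * Ad) * (1 - A * Ad) = 1 - A * Ad := by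
    rw [mul_sub, mul_one, a1.symm, ← mul_assoc, a1, hPAd, zero_mul, sub_zero]
  have hAqn : A - A ^ 2 * Ad = (1 - A * Ad) * A := by rw [← hAP]; noncomm_ring
  have hDdQ : Dd * (1 - D * Dd) = 0 := by
    rw [mul_sub, mul_one, ← mul_assoc, d1, mul_assoc, d2, sub_self]
  -- `Dd Q = 0` and `D C = Q (D C)`, so `Dd C = Dd Dd D C = 0`.
  have hDdC : Dd * C = 0 := by
    have h1 : Dd * (D * C) = 0 := by
      rw [hDC, mul_smul_comm, mul_assoc, mul_assoc, ← mul_assoc Dd, hDdQ, zero_mul, smul_zero]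
    rw [hD.outer, mul_assoc, mul_assoc, ← mul_assoc D, ← d1, mul_assoc Dd, h1, mul_zero]
  have hDC' : D * C = lam⁻¹ • (C * ((1 - A * Ad) * A)) := by
    rw [hDC, sub_mul 1 (D * Dd) C, mul_assoc D, hDdC, mul_zero, one_mul, sub_zero, mul_assoc, hAP]
  have hBDd : B * Dd = 0 := by
    have hqn := hA.quasinilp
    rw [hAqn] at hqn
    refine eq_zero_of_eq_mul_mul (v := lam • Dd) hqn ?_
    calc B * Dd = B * D * Dd * Dd := by rw [mul_assoc, mul_assoc, d2]
      _ = (1 - A * Ad) * A * (B * Dd) * (lam • Dd) := by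
        rw [hBD]
        simp only [smul_mul_assoc, mul_smul_comm, mul_assoc]
  have hAdBD : Ad * (B * D) = 0 := by
    rw [hBD, mul_smul_comm, mul_assoc, ← mul_assoc Ad, hAdP, zero_mul, smul_zero]
  have hDCAd : D * (C * Ad) = 0 := by
    rw [← mul_assoc, hDC', smul_mul_assoc, ← hAP, mul_assoc, mul_assoc, hPAd, mul_zero, mul_zero,
      smul_zero]
  have hterm : ∀ (x : 𝓐) (n : ℕ), x * B * Dd ^ (n + 2) = 0 := by
    intro x n
    rw [pow_succ', mul_assoc, ← mul_assoc B, hBDd, zero_mul, mul_zero]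
  simp only [hterm, Finset.sum_const_zero, tsum_zero, add_zero]
  refine ⟨summable_zero, summable_zero, ?_⟩
  suffices hX : IsGDrazinInverse (!![A, B; C, D] : Matrix (Fin 2) (Fin 2) 𝓐)
      !![Ad, Ad ^ 2 * B; C * Ad ^ 2, Dd + C * Ad ^ 3 * B] from
    ⟨hX, fun Y hY => Matrix.isGDrazinInverse_unique hY hX⟩
  have hBCx : ∀ x : 𝓐, B * (C * x) = 0 := fun x => by rw [← mul_assoc, hBC, zero_mul]
  have hDdCx : ∀ x : 𝓐, Dd * (C * x) = 0 := fun x => by rw [← mul_assoc, hDdC, zero_mul]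
  have hDCAdx : ∀ x : 𝓐, D * (C * (Ad * x)) = 0 := fun x => by
    rw [← mul_assoc C, ← mul_assoc, hDCAd, zero_mul]
  have hBDDd : B * (D * Dd) = 0 := by rw [← d1, ← mul_assoc, hBDd, zero_mul]
  have a3 : Ad * (Ad * A) = Ad := by rw [a1, ← mul_assoc, a1, mul_assoc, a2]
  have a4 : Ad * (A * Ad) = Ad := by rw [← a1, a3]
  have d4 : Dd * (D * Dd) = Dd := by rw [← mul_assoc, d1, mul_assoc, d2]
  have hMX : (!![A, B; C, D] : Matrix (Fin 2) (Fin 2) 𝓐) *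
      !![Ad, Ad ^ 2 * B; C * Ad ^ 2, Dd + C * Ad ^ 3 * B] =
      !![A * Ad, Ad * B; C * Ad, C * (Ad * (Ad * B)) + D * Dd] := by
    simp only [Matrix.mul_fin_two, pow_succ, pow_zero, one_mul, mul_assoc, mul_add, hBCx, hDCAdx,
      a2', hBDd, add_zero]
  have hXM : (!![Ad, Ad ^ 2 * B; C * Ad ^ 2, Dd + C * Ad ^ 3 * B] : Matrix (Fin 2) (Fin 2) 𝓐) *
      !![A, B; C, D] = !![A * Ad, Ad * B; C * Ad, C * (Ad * (Ad * B)) + D * Dd] := by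
    simp only [Matrix.mul_fin_two, pow_succ, pow_zero, one_mul, mul_assoc, add_mul, hBC, hDdC,
      hAdBD, a1, d1, a4, mul_zero, add_zero]
  refine ⟨hXM.trans hMX.symm, ?_, ?_⟩
  · refine Eq.trans ?_ (mul_assoc _ _ _).symm
    rw [hMX]
    simp only [Matrix.mul_fin_two, pow_succ, pow_zero, one_mul, mul_assoc, add_mul, mul_add, hBCx,
      hDdCx, hBDDd, a4, d4, mul_zero, add_zero, add_comm]
  · have hN : (!![A, B; C, D] : Matrix (Fin 2) (Fin 2) 𝓐) - !![A, B; C, D] ^ 2 *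
        !![Ad, Ad ^ 2 * B; C * Ad ^ 2, Dd + C * Ad ^ 3 * B] =
        !![(1 - A * Ad) * A, (1 - A * Ad) * B;
          C * (1 - A * Ad), D - D ^ 2 * Dd - C * Ad * B] := by
      rw [pow_two, mul_assoc, hMX, ← hAqn]
      ext i j
      fin_cases i <;> fin_cases j <;>
        simp [pow_two, mul_assoc, mul_add, sub_mul, mul_sub, hBCx, hDCAdx,
          hBDDd, hDCAd]
      abel
    rw [hN]
    refine Matrix.isQuasinilp_fin_two hlam (fun z => ?_) (fun z => ?_) ?_ ?_ ?_
    · rw [← hAqn]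
      exact hA.quasinilp.isUnit_one_add_smul z
    · -- `C Ad B` squares to zero and `D Q` annihilates it, so `1 + z d` splits as a product.
      have hmul : (D - D ^ 2 * Dd) * (C * Ad * B) = 0 := by
        simp only [pow_two, sub_mul, mul_assoc, hDCAdx, hDdCx, mul_zero, sub_zero]
      have hnil : IsNilpotent (z • (C * Ad * B)) := by
        refine ⟨2, ?_⟩
        simp [pow_two, mul_assoc, hBCx]
      have hfac : 1 + z • (D - D ^ 2 * Dd - C * Ad * B) =
          (1 + z • (D - D ^ 2 * Dd)) * (1 - z • (C * Ad * B)) := by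
        rw [add_mul, mul_sub (z • _), smul_mul_smul_comm, hmul, smul_sub z _ (C * Ad * B)]
        simp only [one_mul, mul_one, smul_zero, sub_zero]
        abel
      rw [hfac]
      exact (hD.quasinilp.isUnit_one_add_smul z).mul hnil.isUnit_one_sub
    · have h1 : B * (D - D ^ 2 * Dd - C * Ad * B) = B * D := by
        have : B * (D * (D * Dd)) = 0 := by
          rw [← d1, ← mul_assoc D, ← d1, mul_assoc, ← mul_assoc, hBDd, zero_mul]
        simp only [pow_two, mul_sub, mul_assoc, hBCx, this, sub_zero]
      rw [mul_assoc (1 - A * Ad) B, h1, hBD, mul_smul_comm]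
      congr 1
      rw [mul_assoc _ A, ← mul_assoc, hPP, mul_assoc (1 - A * Ad) A, ← mul_assoc A, hAP,
        mul_assoc _ A B, ← mul_assoc _ _ (A * B), hPP]
    · have h1 : (D - D ^ 2 * Dd - C * Ad * B) * C = D * C := by
        simp only [pow_two, sub_mul, mul_assoc, hBC, hDdC, mul_zero, sub_zero]
      rw [← mul_assoc, h1, hDC', smul_mul_assoc, ← hAP, mul_assoc, mul_assoc, hPP, hAP,
        mul_assoc C, ← mul_assoc (1 - A * Ad) (1 - A * Ad) A, hPP]
    · rw [mul_assoc, ← mul_assoc B, hBC, zero_mul, mul_zero]
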